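/- Let $\mathbb{C}^+=\{z\in\mathbb{C}:\operatorname{Re} z>0\}$ be the open right half plane and let $\varphi\in H^\infty(\mathbb{C}^+)$, that is, $\varphi$ is a bounded analytic function on $\mathbb{C}^+$. Let $\varphi(it)=\lim_{x\to0^+}\varphi(x+it)$ denote its boundary function on the imaginary axis; this limit exists for almost every $t\in\mathbb{R}$. Let $\alpha\in\mathbb{C}$. Then the following three conditions are equivalent: (1) $\displaystyle\lim_{\theta\to\infty}\frac{1}{2\theta}\int_{-\theta}^{\theta}\varphi(it)\,dt=\alpha$; (2) $\displaystyle\lim_{x\to\infty}\varphi(x+iy)=\alpha$ for some $y\in\mathbb{R}$; (3) $\displaystyle\lim_{x\to\infty}\varphi(x+iy)=\alpha$ for every $y\in\mathbb{R}$. -/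

import Mathlib

open Filter Topology MeasureTheory

/-- The open right half plane `{z : ℂ | 0 < Re z}`. -/
def rightHalfPlane : Set ℂ := {z : ℂ | 0 < z.re}

/-- `φ` belongs to the Hardy space `H^∞` of the right half plane: it is analytic and bounded there.
The values of `φ` outside the open half plane are irrelevant. -/
structure IsHInfty (φ : ℂ → ℂ) : Prop where
  /-- `φ` is holomorphic on the open right half plane. -/
  differentiableOn : DifferentiableOn ℂ φ rightHalfPlane
  /-- `φ` is bounded on the open right half plane. -/
  bounded : ∃ C : ℝ, ∀ z ∈ rightHalfPlane, ‖φ z‖ ≤ C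

/-- The boundary function `t ↦ φ(it)` on the imaginary axis, given by the limit of `φ(x + it)` as
`x → 0+`. It depends only on the values of `φ` in the open half plane; where the limit does not
exist the value is arbitrary. -/
noncomputable def boundaryFunction (φ : ℂ → ℂ) (t : ℝ) : ℂ :=
  limUnder (𝓝[>] (0 : ℝ)) (fun x : ℝ => φ ((x : ℂ) + (t : ℂ) * Complex.I))

/-! Everything is expressed through a primitive `Φ` of `φ`. Since `φ` is bounded, `Φ` is Lipschitz,
hence continuous up to the imaginary axis, and the mean of the boundary function over `[-θ, θ]` is
`(Φ(iθ) - Φ(-iθ)) / (2iθ)`.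

From the means to `φ`: for `f(w) = (1 + w) Φ(x (1 - w) / (1 + w))` on the unit disc, `f(0) - f'(0) =
2xφ(x)`. Cauchy's formulas on the unit circle turn this into an integral of symmetric differences of
`Φ` at `±ix tan(s/2)` against `sin s` (`integral_sin_mul_symm_diff`). The integrands are dominated
because `|sin s tan(s/2)| ≤ 2`, so limits of the difference quotients pass to `φ(x)`
(`tendsto_of_tendsto_symm_diff`). With `x → ∞` this is the Abelian direction. With `x → 0+`, after a
translation, it is Fatou's theorem, because the Lipschitz function `t ↦ Φ(it)` is differentiable
almost everywhere.

From `φ` to the means: by `integral_semicircle` the mean over `[-R, R]` is half the integral of `φ(R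
e^{is}) e^{is}` over `|s| < π/2`. The functions `z ↦ φ(Rz)` are uniformly bounded and tend to `α` on
the positive axis, hence on the whole half plane by a Vitali argument; dominated convergence
finishes.

The choice of `y` is immaterial by the Schwarz lemma on discs of radius `x`. -/

/-! ### Vitali's theorem on the unit disc. -/

/-- Cauchy's estimate for Taylor coefficients at the centre of the unit disc. -/
theorem norm_taylorCoeff_le {f : ℂ → ℂ} {C : ℝ} (hf : DifferentiableOn ℂ f (Metric.ball 0 1))
    (hC : ∀ z ∈ Metric.ball (0 : ℂ) 1, ‖f z‖ ≤ C) (n : ℕ) :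
    ‖((n.factorial : ℂ))⁻¹ * iteratedDeriv n f 0‖ ≤ C := by
  have key : ∀ r ∈ Set.Ioo (0 : ℝ) 1, ‖((n.factorial : ℂ))⁻¹ * iteratedDeriv n f 0‖ ≤ C / r ^ n := by
    intro r hr
    have hsub : Metric.closedBall (0 : ℂ) r ⊆ Metric.ball 0 1 :=
      Metric.closedBall_subset_ball hr.2
    have h := Complex.norm_iteratedDeriv_le_of_forall_mem_sphere_norm_le (f := f) (c := 0) n hr.1
      (hf.mono (by rwa [closure_ball _ hr.1.ne'])).diffContOnCl
      (fun z hz => hC z (hsub (Metric.sphere_subset_closedBall hz)))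
    rw [norm_mul, norm_inv, Complex.norm_natCast]
    have hn : (0 : ℝ) < n.factorial := by positivity
    rw [inv_mul_le_iff₀ hn]
    exact h.trans_eq (mul_div_assoc _ _ _)
  have ht : Tendsto (fun r : ℝ => C / r ^ n) (𝓝[<] 1) (𝓝 C) := by
    have : ContinuousAt (fun r : ℝ => C / r ^ n) 1 := by
      apply ContinuousAt.div continuousAt_const (by fun_prop) (by simp)
    have h := this.tendsto
    simp only [one_pow, div_one] at h
    exact h.mono_left nhdsWithin_le_nhds
  refine ge_of_tendsto ht ?_
  filter_upwards [Ioo_mem_nhdsLT (zero_lt_one' ℝ)] with r hr using key r hr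

/-- A Vitali-type theorem: a uniformly bounded family of holomorphic functions on the unit disc
which tends to zero pointwise on `(0, 1)` tends to zero pointwise on the disc. -/
theorem tendsto_zero_of_tendsto_zero_on_Ioo {ι : Type*} {l : Filter ι} {g : ι → ℂ → ℂ} {C : ℝ}
    (hg : ∀ i, DifferentiableOn ℂ (g i) (Metric.ball 0 1))
    (hC : ∀ i, ∀ z ∈ Metric.ball (0 : ℂ) 1, ‖g i z‖ ≤ C)
    (h0 : ∀ x ∈ Set.Ioo (0 : ℝ) 1, Tendsto (fun i => g i x) l (𝓝 0))
    {w : ℂ} (hw : w ∈ Metric.ball (0 : ℂ) 1) : Tendsto (fun i => g i w) l (𝓝 0) := by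
  rcases isEmpty_or_nonempty ι with hι | ⟨⟨i₀⟩⟩
  · rw [Filter.filter_eq_bot_of_isEmpty l]; exact tendsto_bot
  have hC0 : 0 ≤ C := (norm_nonneg _).trans (hC i₀ 0 (by simp))
  set a : ι → ℕ → ℂ := fun i n => ((n.factorial : ℂ))⁻¹ * iteratedDeriv n (g i) 0 with ha
  have haC : ∀ i n, ‖a i n‖ ≤ C := fun i n => norm_taylorCoeff_le (hg i) (hC i) n
  have hsum : ∀ i, ∀ z ∈ Metric.ball (0 : ℂ) 1, HasSum (fun n => a i n * z ^ n) (g i z) := by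
    intro i z hz
    have := Complex.hasSum_taylorSeries_on_ball (hg i) hz
    have hcoef : (fun n => ((n.factorial : ℂ))⁻¹ • (z - 0) ^ n • iteratedDeriv n (g i) 0)
        = fun n => a i n * z ^ n := by
      funext n
      simp only [ha, sub_zero, smul_eq_mul]
      ring
    rwa [hcoef] at this
  have hlim : ∀ n, Tendsto (fun i => a i n) l (𝓝 0) := by
    intro n
    induction n using Nat.strong_induction_on with
    | _ n ih =>
    -- Solve the Taylor expansion at `x` for its `n`-th term: lower coefficients are controlled by
    -- induction, and the geometric tail is still `O(x)` after division by `x ^ n`.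
    have bound : ∀ x ∈ Set.Ioo (0 : ℝ) 1, ∀ i,
        ‖a i n‖ ≤ (‖g i x‖ + ∑ m ∈ Finset.range n, ‖a i m‖) / x ^ n + C * x / (1 - x) := by
      intro x hx i
      have hxb : (x : ℂ) ∈ Metric.ball (0 : ℂ) 1 := by
        simp [abs_of_pos hx.1, hx.2]
      have hs := hsum i x hxb
      have h1 := hs.summable.sum_add_tsum_nat_add (n + 1)
      rw [hs.tsum_eq, Finset.sum_range_succ] at h1
      have hgeo : HasSum (fun k : ℕ => C * x ^ (n + 1) * x ^ k) (C * x ^ (n + 1) * (1 - x)⁻¹) :=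
        (hasSum_geometric_of_lt_one hx.1.le hx.2).mul_left _
      have htail : ‖∑' k, a i (k + (n + 1)) * (x : ℂ) ^ (k + (n + 1))‖
          ≤ C * x ^ (n + 1) * (1 - x)⁻¹ := by
        refine tsum_of_norm_bounded hgeo fun k => ?_
        rw [norm_mul, norm_pow, Complex.norm_real, Real.norm_of_nonneg hx.1.le, pow_add]
        have := mul_le_mul_of_nonneg_right (haC i (k + (n + 1)))
          (by have := hx.1; positivity : 0 ≤ x ^ k * x ^ (n + 1))
        linarith
      have hhead : ‖∑ m ∈ Finset.range n, a i m * (x : ℂ) ^ m‖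
          ≤ ∑ m ∈ Finset.range n, ‖a i m‖ := by
        refine norm_sum_le_of_le _ fun m _ => ?_
        rw [norm_mul, norm_pow, Complex.norm_real, Real.norm_of_nonneg hx.1.le]
        exact mul_le_of_le_one_right (norm_nonneg _) (pow_le_one₀ hx.1.le hx.2.le)
      have h2 : a i n * (x : ℂ) ^ n = g i x - ∑ m ∈ Finset.range n, a i m * (x : ℂ) ^ m
          - ∑' k, a i (k + (n + 1)) * (x : ℂ) ^ (k + (n + 1)) := by
        rw [← h1]; ring
      have h3 : ‖a i n‖ * x ^ n ≤ ‖g i x‖ + ∑ m ∈ Finset.range n, ‖a i m‖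
          + C * x ^ (n + 1) * (1 - x)⁻¹ := by
        have h4 : ‖a i n * (x : ℂ) ^ n‖ = ‖a i n‖ * x ^ n := by
          rw [norm_mul, norm_pow, Complex.norm_real, Real.norm_of_nonneg hx.1.le]
        rw [← h4, h2]
        exact (norm_sub_le _ _).trans (add_le_add ((norm_sub_le _ _).trans
          (add_le_add le_rfl hhead)) htail)
      have hxn : 0 < x ^ n := pow_pos hx.1 n
      have hx1 : 0 < 1 - x := sub_pos.2 hx.2
      rw [← sub_le_iff_le_add, le_div_iff₀ hxn, sub_mul]
      have : C * x / (1 - x) * x ^ n = C * x ^ (n + 1) * (1 - x)⁻¹ := by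
        field_simp; ring
      linarith
    rw [Metric.tendsto_nhds]
    intro ε hε
    -- Order of choices: `x` is fixed first to make the tail small uniformly in `i`; only then does
    -- `i` run along `l`.
    have hsmall : ∀ᶠ x : ℝ in 𝓝[>] 0, C * x / (1 - x) < ε / 2 := by
      have : ContinuousAt (fun x : ℝ => C * x / (1 - x)) 0 :=
        ContinuousAt.div (by fun_prop) (by fun_prop) (by simp)
      have h := this.tendsto
      simp only [mul_zero, sub_zero, zero_div] at h
      exact (h.mono_left nhdsWithin_le_nhds).eventually (gt_mem_nhds (half_pos hε))
    obtain ⟨x, hxs, hx⟩ := (hsmall.and (Ioo_mem_nhdsGT (zero_lt_one' ℝ))).exists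
    have hl : Tendsto (fun i => (‖g i x‖ + ∑ m ∈ Finset.range n, ‖a i m‖) / x ^ n) l (𝓝 0) := by
      have := ((h0 x hx).norm.add (tendsto_finsetSum (Finset.range n)
        fun m hm => (ih m (Finset.mem_range.1 hm)).norm)).div_const (x ^ n)
      simpa using this
    filter_upwards [hl.eventually (gt_mem_nhds (half_pos hε))] with i hi
    rw [dist_zero_right]
    linarith [bound x hx i]
  have hw1 : ‖w‖ < 1 := by simpa using hw
  have hfin := tendsto_tsum_of_dominated_convergence (𝓕 := l)
    (f := fun i n => a i n * w ^ n) (g := fun _ => 0)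
    (bound := fun n => C * ‖w‖ ^ n) ((summable_geometric_of_lt_one (norm_nonneg _) hw1).mul_left C)
    (fun n => by simpa using (hlim n).mul_const (w ^ n))
    (Eventually.of_forall fun i n => by
      rw [norm_mul, norm_pow]
      exact mul_le_mul_of_nonneg_right (haC i n) (by positivity))
  rw [tsum_zero] at hfin
  exact hfin.congr fun i => (hsum i w hw).tsum_eq

/-! ### The Cayley transform. -/

/-- The Cayley transform, an involution exchanging the unit disc and the right half plane. -/
noncomputable def cayley (z : ℂ) : ℂ := (1 - z) / (1 + z)

theorem one_add_ne_zero_of_norm_lt_one {w : ℂ} (hw : ‖w‖ < 1) : 1 + w ≠ 0 := by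
  intro h
  rw [← norm_neg, ← eq_neg_of_add_eq_zero_left h, norm_one] at hw
  exact lt_irrefl _ hw

theorem one_add_ne_zero_of_re_pos {z : ℂ} (hz : 0 < z.re) : 1 + z ≠ 0 := by
  intro h
  have := congrArg Complex.re h
  simp at this
  linarith

theorem cayley_cayley {z : ℂ} (hz : 1 + z ≠ 0) : cayley (cayley z) = z := by
  have h2 : 1 + (1 - z) / (1 + z) ≠ 0 := by
    rw [one_add_div hz]
    exact div_ne_zero (by ring_nf; norm_num) hz
  unfold cayley
  rw [div_eq_iff h2]
  field_simp
  ring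

theorem cayley_re (z : ℂ) : (cayley z).re = (1 - ‖z‖ ^ 2) / Complex.normSq (1 + z) := by
  rw [cayley, Complex.div_re, ← add_div, ← Complex.normSq_eq_norm_sq]
  congr 1
  simp [Complex.normSq_apply]
  ring

theorem cayley_re_pos {w : ℂ} (hw : ‖w‖ < 1) : 0 < (cayley w).re := by
  rw [cayley_re]
  refine div_pos ?_ (Complex.normSq_pos.2 (one_add_ne_zero_of_norm_lt_one hw))
  nlinarith [norm_nonneg w]

theorem norm_cayley_lt_one {z : ℂ} (hz : 0 < z.re) : ‖cayley z‖ < 1 := by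
  have h := cayley_cayley (one_add_ne_zero_of_re_pos hz)
  have h1 := cayley_re (cayley z)
  rw [h] at h1
  by_contra! hc
  have : (1 - ‖cayley z‖ ^ 2) / Complex.normSq (1 + cayley z) ≤ 0 :=
    div_nonpos_of_nonpos_of_nonneg (by nlinarith) (Complex.normSq_nonneg _)
  linarith

theorem hasDerivAt_cayley {z : ℂ} (hz : 1 + z ≠ 0) :
    HasDerivAt cayley (-2 / (1 + z) ^ 2) z := by
  have h := ((hasDerivAt_id z).const_sub 1).div ((hasDerivAt_id z).const_add 1) hz
  have h2 : (-1 * (1 + z) - (1 - z) * 1) / (1 + z) ^ 2 = -2 / (1 + z) ^ 2 := by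
    congr 1; ring
  rw [← h2]
  exact h

theorem cayley_ofReal (x : ℝ) : cayley x = ((1 - x) / (1 + x) : ℝ) := by
  simp [cayley]

theorem isOpen_rightHalfPlane : IsOpen rightHalfPlane :=
  isOpen_lt continuous_const Complex.continuous_re

/-! ### The Lipschitz primitive, and Vitali's theorem on the half plane. -/

/-- A bounded holomorphic function on the right half plane has a primitive that extends to a
Lipschitz function on the whole plane. -/
theorem IsHInfty.exists_lipschitz_primitive {φ : ℂ → ℂ} (hφ : IsHInfty φ) :
    ∃ (K : NNReal) (Φ : ℂ → ℂ), LipschitzWith K Φ ∧ ∀ z, 0 < z.re → HasDerivAt Φ (φ z) z := by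
  obtain ⟨C, hC⟩ := hφ.bounded
  -- Primitives are available on a disc, so `φ(z) dz` is pulled back by the Cayley transform;
  -- composing back, the two derivative factors cancel.
  have hg : DifferentiableOn ℂ (fun w => φ (cayley w) * (-2 / (1 + w) ^ 2)) (Metric.ball 0 1) := by
    intro w hw
    have hw1 : ‖w‖ < 1 := by simpa using hw
    have h1 := one_add_ne_zero_of_norm_lt_one hw1
    have hd : DifferentiableAt ℂ φ (cayley w) :=
      hφ.differentiableOn.differentiableAt (isOpen_rightHalfPlane.mem_nhds (cayley_re_pos hw1))
    have h2 : DifferentiableAt ℂ (fun w => φ (cayley w)) w :=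
      hd.comp w (hasDerivAt_cayley h1).differentiableAt
    have h3 : DifferentiableAt ℂ (fun w : ℂ => -2 / (1 + w) ^ 2) w :=
      (differentiableAt_const _).div (by fun_prop) (pow_ne_zero 2 h1)
    exact (h2.mul h3).differentiableWithinAt
  obtain ⟨G, hG⟩ := hg.isExactOn_ball
  have hF : ∀ z ∈ rightHalfPlane, HasDerivAt (fun z => G (cayley z)) (φ z) z := by
    intro z hz
    have h1 := one_add_ne_zero_of_re_pos hz
    have hb : cayley z ∈ Metric.ball (0 : ℂ) 1 := by simpa using norm_cayley_lt_one hz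
    have h := (hG _ hb).comp z (hasDerivAt_cayley h1)
    simp only [cayley_cayley h1] at h
    have h2 : 1 + cayley z = 2 / (1 + z) := by
      rw [cayley, one_add_div h1]; congr 1; ring
    have h3 : φ z * (-2 / (1 + cayley z) ^ 2) * (-2 / (1 + z) ^ 2) = φ z := by
      rw [h2]
      field_simp
    rwa [h3] at h
  have hconv : Convex ℝ rightHalfPlane := convex_halfSpace_re_gt 0
  have hL : LipschitzOnWith C.toNNReal (fun z => G (cayley z)) rightHalfPlane :=
    hconv.lipschitzOnWith_of_nnnorm_hasDerivWithin_le
      (fun z hz => (hF z hz).hasDerivWithinAt)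
      (fun z hz => by
        rw [← NNReal.coe_le_coe, coe_nnnorm]
        exact (hC z hz).trans (Real.le_coe_toNNReal C))
  -- The extension may enlarge the Lipschitz constant; only its finiteness matters.
  obtain ⟨Φ, hΦ, heq⟩ := hL.extend_finite_dimension
  refine ⟨_, Φ, hΦ, fun z hz => (hF z hz).congr_of_eventuallyEq ?_⟩
  filter_upwards [isOpen_rightHalfPlane.mem_nhds hz] with w hw using (heq hw).symm

/-- A uniformly bounded family of holomorphic functions on the right half plane which tends to a
constant on the positive real axis tends to this constant on the half plane. -/
theorem tendsto_of_tendsto_on_pos_real {ι : Type*} {l : Filter ι} {g : ι → ℂ → ℂ} {C : ℝ} {α : ℂ}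
    (hg : ∀ i, DifferentiableOn ℂ (g i) rightHalfPlane)
    (hC : ∀ i, ∀ z ∈ rightHalfPlane, ‖g i z‖ ≤ C)
    (h0 : ∀ x : ℝ, 0 < x → Tendsto (fun i => g i x) l (𝓝 α))
    {z : ℂ} (hz : 0 < z.re) : Tendsto (fun i => g i z) l (𝓝 α) := by
  have h := tendsto_zero_of_tendsto_zero_on_Ioo (l := l) (g := fun i w => g i (cayley w) - α)
    (C := C + ‖α‖) ?_ ?_ ?_ (w := cayley z) (by simpa using norm_cayley_lt_one hz)
  · simp only [cayley_cayley (one_add_ne_zero_of_re_pos hz)] at h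
    simpa using h.add_const α
  · intro i w hw
    have hw1 : ‖w‖ < 1 := by simpa using hw
    have hd : DifferentiableAt ℂ (g i) (cayley w) :=
      (hg i).differentiableAt (isOpen_rightHalfPlane.mem_nhds (cayley_re_pos hw1))
    have h2 : DifferentiableAt ℂ (fun w => g i (cayley w)) w :=
      hd.comp w (hasDerivAt_cayley (one_add_ne_zero_of_norm_lt_one hw1)).differentiableAt
    exact (h2.sub_const α).differentiableWithinAt
  · intro i w hw
    exact (norm_sub_le _ _).trans (add_le_add_left (hC i _ (cayley_re_pos (by simpa using hw))) _)
  · intro x hx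
    simp only [cayley_ofReal]
    have := h0 ((1 - x) / (1 + x)) (div_pos (by linarith [hx.2]) (by linarith [hx.1]))
    simpa using this.sub_const α

/-! ### Recovering `φ(x)` from the boundary values of the primitive. -/

/-- The difference of Cauchy's formulas for `f(0)` and `f'(0)`. The kernel is chosen because on the
unit circle its product with `1 + w` is `2i sin s`. -/
theorem integral_circleMap_mul_one_sub_inv {f : ℂ → ℂ}
    (hf : DifferentiableOn ℂ f (Metric.ball 0 1)) {r : ℝ} (hr : r ∈ Set.Ioo (0 : ℝ) 1) :
    ∫ s in (0 : ℝ)..2 * Real.pi, f (circleMap 0 r s) * (1 - (circleMap 0 r s)⁻¹)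
      = 2 * Real.pi * (f 0 - deriv f 0) := by
  have hsub : Metric.closedBall (0 : ℂ) r ⊆ Metric.ball 0 1 := Metric.closedBall_subset_ball hr.2
  have h0 : (0 : ℂ) ∈ Metric.ball (0 : ℂ) r := by simp [hr.1]
  have h1 := (hf.mono hsub).circleIntegral_sub_inv_smul h0
  have h2 := Complex.two_pi_I_inv_smul_circleIntegral_sub_sq_inv_smul_of_differentiable
    Metric.isOpen_ball hsub hf h0
  have hI : (2 * Real.pi * Complex.I : ℂ) ≠ 0 := by simp [Real.pi_ne_zero]
  rw [inv_smul_eq_iff₀ hI] at h2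
  have hz : ∀ z ∈ Metric.sphere (0 : ℂ) r, z - 0 ≠ 0 := fun z hz h => by
    rw [sub_zero] at h
    simp [h] at hz
    exact hr.1.ne hz
  have hfc : ContinuousOn f (Metric.sphere 0 r) :=
    hf.continuousOn.mono (Metric.sphere_subset_closedBall.trans hsub)
  have hi1 : CircleIntegrable (fun z => (z - 0)⁻¹ • f z) 0 r :=
    ContinuousOn.circleIntegrable hr.1.le
      ((ContinuousOn.inv₀ (by fun_prop) hz).smul hfc)
  have hi2 : CircleIntegrable (fun z => ((z - 0) ^ 2)⁻¹ • f z) 0 r :=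
    ContinuousOn.circleIntegrable hr.1.le
      ((ContinuousOn.inv₀ (by fun_prop) fun z h => pow_ne_zero 2 (hz z h)).smul hfc)
  have h3 := circleIntegral.integral_sub hi1 hi2
  rw [h1, h2, ← smul_sub, circleIntegral] at h3
  have h4 : ∀ s : ℝ, deriv (circleMap 0 r) s • ((circleMap 0 r s - 0)⁻¹ • f (circleMap 0 r s)
      - ((circleMap 0 r s - 0) ^ 2)⁻¹ • f (circleMap 0 r s))
      = Complex.I * (f (circleMap 0 r s) * (1 - (circleMap 0 r s)⁻¹)) := by
    intro s
    have : circleMap 0 r s ≠ 0 := circleMap_ne_center hr.1.ne'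
    simp only [deriv_circleMap, sub_zero, smul_eq_mul]
    field_simp
  simp only [h4] at h3
  rw [intervalIntegral.integral_const_mul] at h3
  apply mul_left_cancel₀ Complex.I_ne_zero
  rw [h3, smul_eq_mul]
  ring

/-- Let `r → 1-` in the previous identity. Continuity may fail at `w = -1`, the pole of the Cayley
transform, which is the single parameter `s = π`. -/
theorem integral_boundary_circleMap_mul_one_sub_inv {f : ℂ → ℂ} {M : ℝ}
    (hf : DifferentiableOn ℂ f (Metric.ball 0 1)) (hM : ∀ z ∈ Metric.ball (0 : ℂ) 1, ‖f z‖ ≤ M)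
    (hcont : ∀ w, 1 + w ≠ 0 → ContinuousAt f w) :
    ∫ s in (0 : ℝ)..2 * Real.pi, f (circleMap 0 1 s) * (1 - (circleMap 0 1 s)⁻¹)
      = 2 * Real.pi * (f 0 - deriv f 0) := by
  have hM0 : 0 ≤ M := (norm_nonneg _).trans (hM 0 (by simp))
  -- Keeping `r > 1/2` bounds the kernel by `1 + 2 = 3`.
  have hev : ∀ᶠ r : ℝ in 𝓝[<] 1, r ∈ Set.Ioo (1 / 2 : ℝ) 1 :=
    Ioo_mem_nhdsLT (by norm_num)
  have hmem : ∀ r ∈ Set.Ioo (1 / 2 : ℝ) 1, ∀ s, circleMap 0 r s ∈ Metric.ball (0 : ℂ) 1 := by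
    intro r hr s
    have : 0 < r := by linarith [hr.1]
    simp [abs_of_pos this, hr.2]
  have hlim : Tendsto (fun r : ℝ => ∫ s in (0 : ℝ)..2 * Real.pi,
      f (circleMap 0 r s) * (1 - (circleMap 0 r s)⁻¹)) (𝓝[<] 1)
      (𝓝 (∫ s in (0 : ℝ)..2 * Real.pi, f (circleMap 0 1 s) * (1 - (circleMap 0 1 s)⁻¹))) := by
    refine intervalIntegral.tendsto_integral_filter_of_dominated_convergence (fun _ => M * 3)
      ?_ ?_ intervalIntegrable_const ?_
    · filter_upwards [hev] with r hr
      have hr0 : r ≠ 0 := by linarith [hr.1]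
      refine Continuous.aestronglyMeasurable ?_
      refine (hf.continuousOn.comp_continuous (continuous_circleMap 0 r) (hmem r hr)).mul ?_
      exact continuous_const.sub
        ((continuous_circleMap 0 r).inv₀ fun s => circleMap_ne_center hr0)
    · filter_upwards [hev] with r hr
      refine Eventually.of_forall fun s _ => ?_
      have hr0 : 0 < r := by linarith [hr.1]
      rw [norm_mul]
      refine mul_le_mul (hM _ (hmem r hr s)) ?_ (norm_nonneg _) hM0
      refine (norm_sub_le _ _).trans ?_
      rw [norm_inv, norm_circleMap_zero, abs_of_pos hr0, norm_one]
      have : r⁻¹ ≤ 2 := by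
        rw [inv_le_comm₀ hr0 two_pos]; linarith [hr.1]
      linarith
    · have hne : ∀ᵐ s : ℝ, s ≠ Real.pi := Measure.ae_ne volume Real.pi
      filter_upwards [hne] with s hs hmem
      rw [Set.uIoc_of_le Real.two_pi_pos.le] at hmem
      have hne1 : 1 + circleMap 0 1 s ≠ 0 := by
        intro h
        have hre := congrArg Complex.re h
        simp [circleMap, Complex.exp_ofReal_mul_I_re] at hre
        have h1 : Real.cos (s - Real.pi) = 1 := by rw [Real.cos_sub_pi]; linarith
        have h2 := (Real.cos_eq_one_iff_of_lt_of_lt (by linarith [hmem.1, Real.pi_pos])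
          (by linarith [hmem.2, Real.pi_pos])).1 h1
        exact hs (by linarith)
      have hc : Continuous fun r : ℝ => circleMap 0 r s := by unfold circleMap; fun_prop
      have h1 : Tendsto (fun r : ℝ => circleMap 0 r s) (𝓝[<] 1) (𝓝 (circleMap 0 1 s)) :=
        (hc.tendsto 1).mono_left nhdsWithin_le_nhds
      exact ((hcont _ hne1).tendsto.comp h1).mul
        (tendsto_const_nhds.sub (h1.inv₀ (circleMap_ne_center one_ne_zero)))
  refine tendsto_nhds_unique (hlim.congr' ?_) tendsto_const_nhds
  filter_upwards [hev] with r hr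
  exact integral_circleMap_mul_one_sub_inv hf ⟨by linarith [hr.1], hr.2⟩

/-- No exception is needed at `s = π`: division by zero makes both sides `0` there. -/
theorem cayley_circleMap (s : ℝ) : cayley (circleMap 0 1 s) = -(Complex.I * Real.tan (s / 2)) := by
  set e := Complex.exp (s / 2 * Complex.I) with he
  have he0 : e ≠ 0 := Complex.exp_ne_zero _
  have h1 : circleMap 0 1 s = e * e := by
    rw [he, ← Complex.exp_add]; simp [circleMap]; ring_nf
  have h2 : Complex.exp (-(s / 2) * Complex.I) = e⁻¹ := by rw [neg_mul, Complex.exp_neg]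
  rw [h1, cayley, Complex.ofReal_tan, Complex.tan, Complex.sin, Complex.cos]
  push_cast
  rw [h2, ← he]
  have h3 : 1 - e * e = e * (e⁻¹ - e) := by field_simp
  have h4 : 1 + e * e = e * (e + e⁻¹) := by field_simp; ring
  rw [h3, h4, mul_div_mul_left _ _ he0, div_div_div_cancel_right₀ two_ne_zero]
  linear_combination ((e⁻¹ - e) / (e + e⁻¹)) * Complex.I_mul_I

theorem circleMap_identity (s : ℝ) :
    (1 + circleMap 0 1 s) * (1 - (circleMap 0 1 s)⁻¹) = 2 * Complex.I * Real.sin s := by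
  have h1 : circleMap 0 1 s ≠ 0 := circleMap_ne_center one_ne_zero
  have h2 : (circleMap 0 1 s)⁻¹ = Complex.exp (-s * Complex.I) := by
    rw [neg_mul, Complex.exp_neg]; simp [circleMap]
  have h3 : (1 + circleMap 0 1 s) * (1 - (circleMap 0 1 s)⁻¹)
      = circleMap 0 1 s - (circleMap 0 1 s)⁻¹ := by field_simp; ring
  rw [h3, h2, Complex.ofReal_sin, Complex.sin]
  simp only [circleMap, Complex.ofReal_one, one_mul, zero_add]
  linear_combination (-(Complex.exp (-s * Complex.I) - Complex.exp (s * Complex.I))) * Complex.I_mul_I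

theorem abs_sin_mul_tan_half_le (s : ℝ) : |Real.sin s * Real.tan (s / 2)| ≤ 2 := by
  have h : Real.sin s * Real.tan (s / 2) = 2 * Real.sin (s / 2) ^ 2 ∨ Real.tan (s / 2) = 0 := by
    by_cases hc : Real.cos (s / 2) = 0
    · right; rw [Real.tan_eq_sin_div_cos, hc, div_zero]
    · left
      have h2 : Real.sin s = 2 * Real.sin (s / 2) * Real.cos (s / 2) := by
        rw [← Real.sin_two_mul]; congr 1; ring
      rw [h2, Real.tan_eq_sin_div_cos]
      field_simp
  rcases h with h | h
  · rw [h, abs_of_nonneg (by positivity)]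
    linarith [Real.sin_sq_le_one (s / 2)]
  · simp [h]

theorem measurable_tan_half : Measurable fun s : ℝ => Real.tan (s / 2) := by
  simp only [Real.tan_eq_sin_div_cos]
  fun_prop

/-- In `f(0) - f'(0)` the terms `Φ(x)` cancel and `2xφ(x)` remains. The factor `1 + w` in `f`
compensates the pole of `cayley` at `-1`: as `Φ` grows at most linearly, `f` is bounded on the disc.
-/
theorem integral_sin_mul_primitive {K : NNReal} {φ Φ : ℂ → ℂ} (hΦ : LipschitzWith K Φ)
    (hd : ∀ z, 0 < z.re → HasDerivAt Φ (φ z) z) {x : ℝ} (hx : 0 < x) :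
    ∫ s in (0 : ℝ)..2 * Real.pi, (Real.sin s : ℂ) * Φ (-(Complex.I * (x * Real.tan (s / 2) : ℝ)))
      = -(2 * Real.pi * Complex.I * x * φ x) := by
  set f : ℂ → ℂ := fun w => (1 + w) * Φ (x * cayley w) with hf
  have hre : ∀ w : ℂ, ‖w‖ < 1 → 0 < (x * cayley w).re := fun w hw => by
    rw [Complex.re_ofReal_mul]; exact mul_pos hx (cayley_re_pos hw)
  have hderiv : ∀ w : ℂ, ‖w‖ < 1 → HasDerivAt f
      (Φ (x * cayley w) + (1 + w) * (φ (x * cayley w) * (x * (-2 / (1 + w) ^ 2)))) w := by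
    intro w hw
    have h1 := (hd _ (hre w hw)).comp w
      ((hasDerivAt_cayley (one_add_ne_zero_of_norm_lt_one hw)).const_mul (x : ℂ))
    have h2 := ((hasDerivAt_id w).const_add 1).mul h1
    rw [one_mul] at h2
    exact h2
  have hbound : ∀ w : ℂ, ‖w‖ < 1 → ‖f w‖ ≤ 2 * ‖Φ 0‖ + K * (x * 2) := by
    intro w hw
    have h1 : ‖Φ (x * cayley w)‖ ≤ ‖Φ 0‖ + K * ‖x * cayley w‖ := by
      have := hΦ.dist_le_mul (x * cayley w) 0
      rw [dist_eq_norm, dist_zero_right] at this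
      linarith [norm_sub_norm_le (Φ (x * cayley w)) (Φ 0)]
    have h2 : ‖1 + w‖ * ‖x * cayley w‖ = x * ‖1 - w‖ := by
      have : ‖1 + w‖ ≠ 0 := norm_ne_zero_iff.2 (one_add_ne_zero_of_norm_lt_one hw)
      rw [norm_mul, Complex.norm_real, Real.norm_of_nonneg hx.le, cayley, norm_div]
      field_simp
    have h3 : ‖1 + w‖ ≤ 2 := (norm_add_le _ _).trans (by rw [norm_one]; linarith)
    have h4 : ‖1 - w‖ ≤ 2 := (norm_sub_le _ _).trans (by rw [norm_one]; linarith)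
    calc ‖f w‖ = ‖1 + w‖ * ‖Φ (x * cayley w)‖ := norm_mul _ _
      _ ≤ ‖1 + w‖ * (‖Φ 0‖ + K * ‖x * cayley w‖) := by gcongr
      _ = ‖1 + w‖ * ‖Φ 0‖ + K * (‖1 + w‖ * ‖x * cayley w‖) := by ring
      _ ≤ 2 * ‖Φ 0‖ + K * (x * 2) := by rw [h2]; gcongr
  have h := integral_boundary_circleMap_mul_one_sub_inv (f := f)
    (fun w hw => (hderiv w (by simpa using hw)).differentiableAt.differentiableWithinAt)
    (fun w hw => hbound w (by simpa using hw))
    (fun w hw => by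
      have := (hasDerivAt_cayley hw).continuousAt
      exact (continuousAt_const.add continuousAt_id).mul
        (hΦ.continuous.continuousAt.comp (continuousAt_const.mul this)))
  rw [(hderiv 0 (by simp)).deriv] at h
  have hpt : ∀ s : ℝ, f (circleMap 0 1 s) * (1 - (circleMap 0 1 s)⁻¹)
      = 2 * Complex.I * (Real.sin s * Φ (-(Complex.I * (x * Real.tan (s / 2) : ℝ)))) := by
    intro s
    have h1 : (x : ℂ) * -(Complex.I * Real.tan (s / 2))
        = -(Complex.I * (x * Real.tan (s / 2) : ℝ)) := by push_cast; ring
    have h2 := circleMap_identity s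
    simp only [hf]
    rw [cayley_circleMap, h1]
    linear_combination Φ (-(Complex.I * (x * Real.tan (s / 2) : ℝ))) * h2
  simp only [hpt] at h
  rw [intervalIntegral.integral_const_mul] at h
  have hc0 : cayley 0 = 1 := by simp [cayley]
  have hf0 : f 0 = Φ x := by simp [hf, hc0]
  rw [hf0, hc0] at h
  simp only [mul_one, add_zero, one_pow, one_mul, div_one] at h
  apply mul_left_cancel₀ (mul_ne_zero two_ne_zero Complex.I_ne_zero)
  rw [h]
  linear_combination (4 * Real.pi * x * φ x) * Complex.I_mul_I

/-- The value of `φ` at `x` in terms of symmetric differences of the boundary values of its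
primitive. -/
theorem integral_sin_mul_symm_diff {K : NNReal} {φ Φ : ℂ → ℂ} (hΦ : LipschitzWith K Φ)
    (hd : ∀ z, 0 < z.re → HasDerivAt Φ (φ z) z) {x : ℝ} (hx : 0 < x) :
    ∫ s in (0 : ℝ)..2 * Real.pi, (Real.sin s : ℂ) *
        ((Φ (Complex.I * (x * Real.tan (s / 2) : ℝ)) - Φ (-(Complex.I * (x * Real.tan (s / 2) : ℝ))))
          / x)
      = 4 * Real.pi * Complex.I * φ x := by
  have hm := measurable_tan_half
  have hΦm : Measurable Φ := hΦ.continuous.measurable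
  have hint : ∀ c : ℂ, ‖c‖ = 1 → IntervalIntegrable
      (fun s : ℝ => (Real.sin s : ℂ) * Φ (c * (x * Real.tan (s / 2) : ℝ))) volume 0
        (2 * Real.pi) := by
    intro c hc
    refine (intervalIntegrable_const (c := ‖Φ 0‖ + K * (x * 2))).mono_fun
      (Measurable.aestronglyMeasurable ?_) (Eventually.of_forall fun s => ?_)
    · exact (Complex.measurable_ofReal.comp Real.measurable_sin).mul (hΦm.comp
        (measurable_const.mul (Complex.measurable_ofReal.comp (measurable_const.mul hm))))
    · have h1 : ‖Φ (c * (x * Real.tan (s / 2) : ℝ))‖ ≤ ‖Φ 0‖ + K * (x * |Real.tan (s / 2)|) := by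
        have := hΦ.dist_le_mul (c * (x * Real.tan (s / 2) : ℝ)) 0
        rw [dist_eq_norm, dist_zero_right, norm_mul, hc, one_mul, Complex.norm_real, Real.norm_eq_abs,
          abs_mul, abs_of_pos hx] at this
        linarith [norm_sub_norm_le (Φ (c * (x * Real.tan (s / 2) : ℝ))) (Φ 0)]
      have h2 := abs_sin_mul_tan_half_le s
      rw [abs_mul] at h2
      beta_reduce
      rw [norm_mul, Complex.norm_real, Real.norm_eq_abs, Real.norm_of_nonneg (by positivity)]
      calc |Real.sin s| * ‖Φ (c * (x * Real.tan (s / 2) : ℝ))‖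
          ≤ |Real.sin s| * (‖Φ 0‖ + K * (x * |Real.tan (s / 2)|)) := by gcongr
        _ = |Real.sin s| * ‖Φ 0‖ + K * (x * (|Real.sin s| * |Real.tan (s / 2)|)) := by ring
        _ ≤ 1 * ‖Φ 0‖ + K * (x * 2) := by gcongr; exact Real.abs_sin_le_one s
        _ = _ := by ring
  have h1 := integral_sin_mul_primitive hΦ hd hx
  have h2 : ∫ s in (0 : ℝ)..2 * Real.pi, (Real.sin s : ℂ) *
      Φ (Complex.I * (x * Real.tan (s / 2) : ℝ)) = 2 * Real.pi * Complex.I * x * φ x := by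
    -- The reflection `s ↦ 2π - s` changes the sign of both `sin s` and `tan (s / 2)`, so the
    -- formula at the conjugate points has the opposite sign.
    have h3 := intervalIntegral.integral_comp_sub_left (a := 0) (b := 2 * Real.pi)
      (fun s : ℝ => (Real.sin s : ℂ) * Φ (-(Complex.I * (x * Real.tan (s / 2) : ℝ))))
      (2 * Real.pi)
    rw [sub_self, sub_zero, h1] at h3
    have h4 : ∀ s : ℝ, Real.tan ((2 * Real.pi - s) / 2) = -Real.tan (s / 2) := fun s => by
      rw [show (2 * Real.pi - s) / 2 = Real.pi - s / 2 by ring, Real.tan_pi_sub]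
    simp only [h4, Real.sin_two_pi_sub, mul_neg, Complex.ofReal_neg, neg_neg, neg_mul,
      intervalIntegral.integral_neg, neg_inj] at h3
    exact h3
  have hx0 : (x : ℂ) ≠ 0 := Complex.ofReal_ne_zero.2 hx.ne'
  have hi1 := hint Complex.I Complex.norm_I
  have hi2 := hint (-Complex.I) (by simp)
  simp only [neg_mul] at hi2
  have h5 : ∀ s : ℝ, (Real.sin s : ℂ) * ((Φ (Complex.I * (x * Real.tan (s / 2) : ℝ))
      - Φ (-(Complex.I * (x * Real.tan (s / 2) : ℝ)))) / x)
      = (x : ℂ)⁻¹ * ((Real.sin s : ℂ) * Φ (Complex.I * (x * Real.tan (s / 2) : ℝ))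
        - (Real.sin s : ℂ) * Φ (-(Complex.I * (x * Real.tan (s / 2) : ℝ)))) := fun s => by ring
  simp only [h5]
  rw [intervalIntegral.integral_const_mul, intervalIntegral.integral_sub hi1 hi2, h1, h2]
  field_simp
  ring

/-! ### Passing to the limit, and Fatou's theorem. -/

/-- If the symmetric difference quotients of the boundary values of the primitive converge, then so
do the values of `φ` on the positive real axis. -/
theorem tendsto_of_tendsto_symm_diff {K : NNReal} {φ Φ : ℂ → ℂ} (hΦ : LipschitzWith K Φ)
    (hd : ∀ z, 0 < z.re → HasDerivAt Φ (φ z) z) {l : Filter ℝ}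
    [l.IsCountablyGenerated]
    (hl : ∀ᶠ x in l, 0 < x) {α : ℂ}
    (h : ∀ τ : ℝ, Tendsto (fun x : ℝ => (Φ (Complex.I * (x * τ : ℝ))
      - Φ (-(Complex.I * (x * τ : ℝ)))) / x) l (𝓝 (2 * Complex.I * τ * α))) :
    Tendsto (fun x : ℝ => φ x) l (𝓝 α) := by
  have hm := measurable_tan_half
  have hΦm : Measurable Φ := hΦ.continuous.measurable
  have hlim := intervalIntegral.tendsto_integral_filter_of_dominated_convergence
    (μ := volume) (a := 0) (b := 2 * Real.pi) (l := l)
    (F := fun x s => (Real.sin s : ℂ) * ((Φ (Complex.I * (x * Real.tan (s / 2) : ℝ))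
      - Φ (-(Complex.I * (x * Real.tan (s / 2) : ℝ)))) / x))
    (f := fun s => (Real.sin s : ℂ) * (2 * Complex.I * (Real.tan (s / 2) : ℝ) * α))
    (fun _ => K * 4) ?_ ?_ intervalIntegrable_const ?_
  -- The limit integral is evaluated by the same formula for `φ = 1`, `Φ = id`, `x = 1`.
  · have hconst := integral_sin_mul_symm_diff (K := 1) (φ := fun _ => 1) (Φ := id) LipschitzWith.id
      (fun z _ => hasDerivAt_id z) one_pos
    have h1 : ∀ s : ℝ, (Real.sin s : ℂ) * (2 * Complex.I * (Real.tan (s / 2) : ℝ) * α)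
        = (Real.sin s : ℂ) * ((id (Complex.I * (1 * Real.tan (s / 2) : ℝ))
        - id (-(Complex.I * (1 * Real.tan (s / 2) : ℝ)))) / (1 : ℝ)) * α := fun s => by
      simp only [id, one_mul, Complex.ofReal_one, div_one]; ring
    simp only [h1] at hlim
    rw [intervalIntegral.integral_mul_const, hconst] at hlim
    have hpi : (4 * Real.pi * Complex.I : ℂ) ≠ 0 := by simp [Real.pi_ne_zero]
    have h2 : Tendsto (fun x : ℝ => 4 * Real.pi * Complex.I * φ x) l
        (𝓝 (4 * Real.pi * Complex.I * α)) := by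
      rw [mul_one] at hlim
      refine hlim.congr' ?_
      filter_upwards [hl] with x hx using integral_sin_mul_symm_diff hΦ hd hx
    have h3 := h2.const_mul (4 * Real.pi * Complex.I : ℂ)⁻¹
    simpa only [inv_mul_cancel_left₀ hpi] using h3
  · refine Eventually.of_forall fun x => Measurable.aestronglyMeasurable ?_
    have h1 : Measurable fun s : ℝ => Complex.I * (x * Real.tan (s / 2) : ℝ) :=
      measurable_const.mul (Complex.measurable_ofReal.comp (measurable_const.mul hm))
    exact (Complex.measurable_ofReal.comp Real.measurable_sin).mul
      (((hΦm.comp h1).sub (hΦm.comp h1.neg)).div_const _)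
  · filter_upwards [hl] with x hx
    refine Eventually.of_forall fun s _ => ?_
    have h1 := hΦ.dist_le_mul (Complex.I * (x * Real.tan (s / 2) : ℝ))
      (-(Complex.I * (x * Real.tan (s / 2) : ℝ)))
    rw [dist_eq_norm, dist_eq_norm, sub_neg_eq_add, ← two_mul, norm_mul 2,
      norm_mul Complex.I, Complex.norm_I, one_mul,
      Complex.norm_real, Real.norm_eq_abs, abs_mul, abs_of_pos hx, Complex.norm_ofNat] at h1
    have h2 := abs_sin_mul_tan_half_le s
    rw [abs_mul] at h2
    rw [norm_mul, norm_div, Complex.norm_real, Complex.norm_real, Real.norm_eq_abs,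
      Real.norm_of_nonneg hx.le]
    calc _ ≤ |Real.sin s| * (K * (2 * (x * |Real.tan (s / 2)|)) / x) := by gcongr
      _ = K * 2 * (|Real.sin s| * |Real.tan (s / 2)|) := by field_simp
      _ ≤ K * 2 * 2 := by gcongr
      _ = K * 4 := by ring
  · exact Eventually.of_forall fun s _ => (h (Real.tan (s / 2))).const_mul _

/-- **Fatou's theorem** for the derivative of a function that is Lipschitz up to the boundary. -/
theorem ae_exists_tendsto_boundary {K : NNReal} {φ Φ : ℂ → ℂ} (hΦ : LipschitzWith K Φ)
    (hd : ∀ z, 0 < z.re → HasDerivAt Φ (φ z) z) :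
    ∀ᵐ t : ℝ, ∃ L : ℂ, Tendsto (fun x : ℝ => φ ((x : ℂ) + (t : ℂ) * Complex.I)) (𝓝[>] (0 : ℝ))
      (𝓝 L) := by
  have hline : LipschitzWith 1 fun t : ℝ => (t : ℂ) * Complex.I :=
    LipschitzWith.of_dist_le_mul fun s t => by
      rw [dist_eq_norm, ← sub_mul, norm_mul, Complex.norm_I, mul_one, ← Complex.ofReal_sub,
        Complex.norm_real, NNReal.coe_one, one_mul, dist_eq_norm]
  -- Rademacher's theorem on the line; at each such `t` the symmetric quotients for every `τ`
  -- converge to `2τL`, where `L` is the derivative of `t ↦ Φ(it)`.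
  filter_upwards [(hΦ.comp hline).ae_differentiableAt_real] with t ht
  set L := deriv (Φ ∘ fun t : ℝ => (t : ℂ) * Complex.I) t with hL
  refine ⟨-Complex.I * L, ?_⟩
  refine tendsto_of_tendsto_symm_diff (K := K) (Φ := fun z => Φ (z + t * Complex.I))
    (φ := fun z => φ (z + t * Complex.I)) ?_ ?_ self_mem_nhdsWithin ?_
  · exact LipschitzWith.of_dist_le_mul fun z w => by
      simpa using hΦ.dist_le_mul (z + t * Complex.I) (w + t * Complex.I)
  · intro z hz
    exact (hd _ (by simpa using hz)).comp_add_const z (t * Complex.I)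
  · intro τ
    have h1 : ∀ c : ℝ, HasDerivAt
        (fun x : ℝ => (Φ ∘ fun t : ℝ => (t : ℂ) * Complex.I) (t + x * c)) (c • L) 0 := by
      intro c
      have hi : HasDerivAt (fun x : ℝ => t + x * c) c 0 := by
        simpa using ((hasDerivAt_id (0 : ℝ)).mul_const c).const_add t
      have hg : HasDerivAt (Φ ∘ fun t : ℝ => (t : ℂ) * Complex.I) L (t + 0 * c) := by
        rw [zero_mul, add_zero]; exact ht.hasDerivAt
      exact hg.scomp 0 hi
    have h2 := ((h1 τ).sub (h1 (-τ))).tendsto_slope_zero_right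
    have h3 : τ • L - (-τ) • L = 2 * Complex.I * τ * (-Complex.I * L) := by
      simp only [Complex.real_smul, Complex.ofReal_neg]
      linear_combination 2 * τ * L * Complex.I_mul_I
    rw [h3] at h2
    refine h2.congr fun x => ?_
    simp only [Pi.sub_apply, Function.comp_apply, zero_add, zero_mul, sub_self, sub_zero,
      Complex.real_smul, Complex.ofReal_inv]
    rw [div_eq_inv_mul]
    congr 3 <;> push_cast <;> ring

theorem tendsto_boundaryFunction {φ : ℂ → ℂ} {t : ℝ}
    (h : ∃ L : ℂ, Tendsto (fun x : ℝ => φ ((x : ℂ) + (t : ℂ) * Complex.I)) (𝓝[>] (0 : ℝ)) (𝓝 L)) :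
    Tendsto (fun x : ℝ => φ ((x : ℂ) + (t : ℂ) * Complex.I)) (𝓝[>] (0 : ℝ))
      (𝓝 (boundaryFunction φ t)) :=
  tendsto_nhds_limUnder h

theorem ae_tendsto_boundaryFunction {φ : ℂ → ℂ} (hφ : IsHInfty φ) :
    ∀ᵐ t : ℝ, Tendsto (fun x : ℝ => φ ((x : ℂ) + (t : ℂ) * Complex.I)) (𝓝[>] (0 : ℝ))
      (𝓝 (boundaryFunction φ t)) := by
  obtain ⟨K, Φ, hΦ, hd⟩ := hφ.exists_lipschitz_primitive
  filter_upwards [ae_exists_tendsto_boundary hΦ hd] with t ht using tendsto_boundaryFunction ht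

theorem add_ofReal_mul_I_mem_rightHalfPlane {x : ℝ} (hx : 0 < x) (t : ℝ) :
    (x : ℂ) + (t : ℂ) * Complex.I ∈ rightHalfPlane := by
  simpa [rightHalfPlane] using hx

/-! ### Integrals of `φ` over the boundary and over semicircles. -/

/-- The fundamental theorem of calculus for the boundary function. -/
theorem integral_boundaryFunction {φ : ℂ → ℂ} (hφ : IsHInfty φ) {K : NNReal} {Φ : ℂ → ℂ}
    (hΦ : LipschitzWith K Φ) (hd : ∀ z, 0 < z.re → HasDerivAt Φ (φ z) z) (a b : ℝ) :
    Complex.I * ∫ t in a..b, boundaryFunction φ t = Φ (b * Complex.I) - Φ (a * Complex.I) := by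
  obtain ⟨C, hC⟩ := hφ.bounded
  have hpos : ∀ᶠ x : ℝ in 𝓝[>] 0, 0 < x := self_mem_nhdsWithin
  have hcont : ∀ x : ℝ, 0 < x → Continuous fun t : ℝ => φ ((x : ℂ) + (t : ℂ) * Complex.I) :=
    fun x hx => hφ.differentiableOn.continuousOn.comp_continuous (by fun_prop)
      (add_ofReal_mul_I_mem_rightHalfPlane hx)
  have hlim := intervalIntegral.tendsto_integral_filter_of_dominated_convergence
    (μ := volume) (a := a) (b := b) (l := 𝓝[>] (0 : ℝ))
    (F := fun x t => φ ((x : ℂ) + (t : ℂ) * Complex.I)) (f := boundaryFunction φ) (fun _ => C)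
    (hpos.mono fun x hx => (hcont x hx).aestronglyMeasurable)
    (hpos.mono fun x hx => Eventually.of_forall fun t _ =>
      hC _ (add_ofReal_mul_I_mem_rightHalfPlane hx t))
    intervalIntegrable_const
    ((ae_tendsto_boundaryFunction hφ).mono fun t ht _ => ht)
  have hftc : ∀ x : ℝ, 0 < x → Complex.I * ∫ t in a..b, φ ((x : ℂ) + (t : ℂ) * Complex.I)
      = Φ (x + b * Complex.I) - Φ (x + a * Complex.I) := by
    intro x hx
    rw [← intervalIntegral.integral_const_mul]
    refine intervalIntegral.integral_eq_sub_of_hasDerivAt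
      (f := fun t : ℝ => Φ ((x : ℂ) + (t : ℂ) * Complex.I)) (fun t _ => ?_)
      ((continuous_const.mul (hcont x hx)).intervalIntegrable _ _)
    have h1 : HasDerivAt (fun t : ℝ => (x : ℂ) + (t : ℂ) * Complex.I) Complex.I t := by
      simpa using ((Complex.ofRealCLM.hasDerivAt (x := t)).mul_const Complex.I).const_add (x : ℂ)
    have h2 := (hd ((x : ℂ) + (t : ℂ) * Complex.I)
      (add_ofReal_mul_I_mem_rightHalfPlane hx t)).comp_of_eq t h1 rfl
    rw [mul_comm]
    exact h2
  have hΦlim : ∀ c : ℝ, Tendsto (fun x : ℝ => Φ (x + c * Complex.I)) (𝓝[>] 0)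
      (𝓝 (Φ (c * Complex.I))) := by
    intro c
    have : Continuous fun x : ℝ => Φ (x + c * Complex.I) := hΦ.continuous.comp (by fun_prop)
    have h := this.tendsto 0
    simp only [Complex.ofReal_zero, zero_add] at h
    exact h.mono_left nhdsWithin_le_nhds
  refine tendsto_nhds_unique (hlim.const_mul Complex.I)
    (((hΦlim b).sub (hΦlim a)).congr' ?_)
  filter_upwards [hpos] with x hx using (hftc x hx).symm

theorem ofReal_mul_exp_mem_rightHalfPlane {R : ℝ} (hR : 0 < R) {s : ℝ}
    (hs : s ∈ Set.Ioo (-(Real.pi / 2)) (Real.pi / 2)) :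
    (R : ℂ) * Complex.exp (s * Complex.I) ∈ rightHalfPlane := by
  change 0 < ((R : ℂ) * Complex.exp (s * Complex.I)).re
  rw [Complex.re_ofReal_mul, Complex.exp_ofReal_mul_I_re]
  exact mul_pos hR (Real.cos_pos_of_mem_Ioo hs)

/-- At the endpoints `±iR` the values of `φ` are arbitrary, so continuity and the bound are used on
the open interval only. -/
theorem intervalIntegrable_semicircle {φ : ℂ → ℂ} (hφ : IsHInfty φ) {R : ℝ} (hR : 0 < R) :
    IntervalIntegrable (fun s : ℝ => φ (R * Complex.exp (s * Complex.I)) *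
      Complex.exp (s * Complex.I)) volume (-(Real.pi / 2)) (Real.pi / 2) := by
  obtain ⟨C, hC⟩ := hφ.bounded
  have hle : -(Real.pi / 2) ≤ Real.pi / 2 := by linarith [Real.pi_pos]
  have hpath : Continuous fun s : ℝ => (R : ℂ) * Complex.exp (s * Complex.I) := by fun_prop
  have hcont : ContinuousOn (fun s : ℝ => φ (R * Complex.exp (s * Complex.I)) *
      Complex.exp (s * Complex.I)) (Set.Ioo (-(Real.pi / 2)) (Real.pi / 2)) :=
    (hφ.differentiableOn.continuousOn.comp hpath.continuousOn
      fun s hs => ofReal_mul_exp_mem_rightHalfPlane hR hs).mul (by fun_prop)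
  rw [intervalIntegrable_iff_integrableOn_Ioo_of_le hle]
  refine IntegrableOn.of_bound measure_Ioo_lt_top
    (hcont.aestronglyMeasurable measurableSet_Ioo) C ?_
  refine (ae_restrict_iff' measurableSet_Ioo).2 (Eventually.of_forall fun s hs => ?_)
  rw [norm_mul, Complex.norm_exp_ofReal_mul_I, mul_one]
  exact hC _ (ofReal_mul_exp_mem_rightHalfPlane hR hs)

/-- The integral of `φ` over the semicircle of radius `R` in terms of its primitive. -/
theorem integral_semicircle {φ : ℂ → ℂ} (hφ : IsHInfty φ) {K : NNReal} {Φ : ℂ → ℂ}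
    (hΦ : LipschitzWith K Φ) (hd : ∀ z, 0 < z.re → HasDerivAt Φ (φ z) z) {R : ℝ} (hR : 0 < R) :
    ∫ s in (-(Real.pi / 2))..(Real.pi / 2),
        φ (R * Complex.exp (s * Complex.I)) * Complex.exp (s * Complex.I)
      = (Φ (R * Complex.I) - Φ (-(R * Complex.I))) / (R * Complex.I) := by
  have hder : ∀ s : ℝ, HasDerivAt (fun s : ℝ => (R : ℂ) * Complex.exp (s * Complex.I))
      (R * (Complex.exp (s * Complex.I) * Complex.I)) s := fun s => by
    have h1 : HasDerivAt (fun s : ℝ => (s : ℂ) * Complex.I) Complex.I s := by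
      simpa using (Complex.ofRealCLM.hasDerivAt (x := s)).mul_const Complex.I
    exact h1.cexp.const_mul _
  have hle : -(Real.pi / 2) ≤ Real.pi / 2 := by linarith [Real.pi_pos]
  have hpath : Continuous fun s : ℝ => (R : ℂ) * Complex.exp (s * Complex.I) := by fun_prop
  have hne : (R * Complex.I : ℂ) ≠ 0 :=
    mul_ne_zero (Complex.ofReal_ne_zero.2 hR.ne') Complex.I_ne_zero
  -- This version asks for a derivative only in the interior; at the endpoints the continuity of `Φ`
  -- suffices.
  have hftc := intervalIntegral.integral_eq_sub_of_hasDerivAt_of_le hle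
    (f := fun s : ℝ => Φ (R * Complex.exp (s * Complex.I)))
    (f' := fun s : ℝ => (R * Complex.I) * (φ (R * Complex.exp (s * Complex.I)) *
      Complex.exp (s * Complex.I)))
    (hΦ.continuous.comp hpath).continuousOn
    (fun s hs => by
      have h := (hd _ (ofReal_mul_exp_mem_rightHalfPlane hR hs)).comp_of_eq s (hder s) rfl
      have h1 : (R * Complex.I) * (φ (R * Complex.exp (s * Complex.I)) *
          Complex.exp (s * Complex.I)) = φ (R * Complex.exp (s * Complex.I)) *
          (R * (Complex.exp (s * Complex.I) * Complex.I)) := by ring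
      rw [h1]
      exact h) ((intervalIntegrable_semicircle hφ hR).const_mul _)
  rw [intervalIntegral.integral_const_mul] at hftc
  rw [eq_div_iff hne, mul_comm, hftc]
  push_cast
  rw [Complex.exp_pi_div_two_mul_I, neg_mul, Complex.exp_neg, Complex.exp_pi_div_two_mul_I,
    Complex.inv_I, mul_neg]

/-! ### Independence of the horizontal line. -/

/-- Along horizontal lines, `φ` has the same behaviour at infinity. -/
theorem IsHInfty.tendsto_sub_horizontal {φ : ℂ → ℂ} (hφ : IsHInfty φ) (y y' : ℝ) :
    Tendsto (fun x : ℝ => φ ((x : ℂ) + (y : ℂ) * Complex.I) - φ ((x : ℂ) + (y' : ℂ) * Complex.I))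
      atTop (𝓝 0) := by
  obtain ⟨C, hC⟩ := hφ.bounded
  have hb : Tendsto (fun x : ℝ => 2 * C / x * |y - y'|) atTop (𝓝 0) := by
    simpa using (tendsto_const_nhds.div_atTop tendsto_id).mul_const (|y - y'|)
  refine squeeze_zero_norm' ?_ hb
  filter_upwards [eventually_gt_atTop |y - y'|] with x hx
  have hx0 : 0 < x := (abs_nonneg _).trans_lt hx
  set c : ℂ := (x : ℂ) + (y' : ℂ) * Complex.I with hc
  have hball : Metric.ball c x ⊆ rightHalfPlane := by
    intro z hz
    have h1 : |(z - c).re| < x := (Complex.abs_re_le_norm _).trans_lt (mem_ball_iff_norm.1 hz)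
    have h2 : (z - c).re = z.re - x := by simp [hc]
    rw [h2, abs_lt] at h1
    change 0 < z.re
    linarith [h1.1]
  have hdist : dist ((x : ℂ) + (y : ℂ) * Complex.I) c = |y - y'| := by
    rw [dist_eq_norm, hc, add_sub_add_left_eq_sub, ← sub_mul, norm_mul, Complex.norm_I, mul_one,
      ← Complex.ofReal_sub, Complex.norm_real, Real.norm_eq_abs]
  -- Schwarz lemma on the disc of radius `x` about `x + iy'`, which lies in the half plane; the
  -- oscillation of `φ` from its central value is at most `2 * C`.
  have h := Complex.dist_le_div_mul_dist_of_mapsTo_ball (f := φ) (c := c) (R₁ := x) (R₂ := 2 * C)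
    (z := (x : ℂ) + (y : ℂ) * Complex.I) (hφ.differentiableOn.mono hball)
    (fun z hz => by
      rw [mem_closedBall_iff_norm]
      refine (norm_sub_le _ _).trans ?_
      linarith [hC z (hball hz), hC c (hball (Metric.mem_ball_self hx0))])
    (by rw [Metric.mem_ball, hdist]; exact hx)
  rwa [hdist, dist_eq_norm] at h

/-! ### The Abelian and Tauberian directions. -/

/-- The means of the boundary function in terms of the primitive. -/
theorem mean_boundaryFunction {φ : ℂ → ℂ} (hφ : IsHInfty φ) {K : NNReal} {Φ : ℂ → ℂ}
    (hΦ : LipschitzWith K Φ) (hd : ∀ z, 0 < z.re → HasDerivAt Φ (φ z) z) (θ : ℝ) :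
    (1 / (2 * (θ : ℂ))) * ∫ t in (-θ)..θ, boundaryFunction φ t
      = (Φ (θ * Complex.I) - Φ (-(θ * Complex.I))) / (2 * (θ * Complex.I)) := by
  have h := integral_boundaryFunction hφ hΦ hd (-θ) θ
  rw [Complex.ofReal_neg, neg_mul] at h
  rw [← h, ← mul_assoc 2, mul_comm Complex.I, mul_div_mul_right _ _ Complex.I_ne_zero]
  ring

/-- Abelian direction: convergence of the means of the boundary function implies convergence on the
positive real axis. -/
theorem tendsto_real_of_tendsto_mean {φ : ℂ → ℂ} (hφ : IsHInfty φ) {α : ℂ}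
    (h : Tendsto (fun θ : ℝ => (1 / (2 * (θ : ℂ))) * ∫ t in (-θ)..θ, boundaryFunction φ t)
      atTop (𝓝 α)) : Tendsto (fun x : ℝ => φ x) atTop (𝓝 α) := by
  obtain ⟨K, Φ, hΦ, hd⟩ := hφ.exists_lipschitz_primitive
  simp only [mean_boundaryFunction hφ hΦ hd] at h
  set N : ℝ → ℂ := fun θ => (Φ (θ * Complex.I) - Φ (-(θ * Complex.I))) / (2 * (θ * Complex.I))
    with hN
  -- Evenness covers negative `τ`, which occur because `tan (s / 2)` takes both signs.
  have heven : ∀ θ, N (-θ) = N θ := fun θ => by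
    simp only [hN, Complex.ofReal_neg, neg_mul, neg_neg, mul_neg, div_neg]
    rw [← neg_div, neg_sub]
  have hbot : Tendsto N atBot (𝓝 α) :=
    (h.comp tendsto_neg_atBot_atTop).congr fun θ => heven θ
  refine tendsto_of_tendsto_symm_diff hΦ hd (eventually_gt_atTop 0) fun τ => ?_
  rcases eq_or_ne τ 0 with rfl | hτ
  · simp
  have hcomp : Tendsto (fun x : ℝ => N (x * τ)) atTop (𝓝 α) := by
    rcases hτ.lt_or_gt with hτ | hτ
    · exact hbot.comp (tendsto_id.atTop_mul_const_of_neg hτ)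
    · exact h.comp (tendsto_id.atTop_mul_const hτ)
  refine (hcomp.const_mul (2 * Complex.I * τ)).congr' ?_
  filter_upwards [eventually_gt_atTop 0] with x hx
  have hx0 : (x : ℂ) ≠ 0 := Complex.ofReal_ne_zero.2 hx.ne'
  have hτ0 : (τ : ℂ) ≠ 0 := Complex.ofReal_ne_zero.2 hτ
  simp only [hN, mul_comm _ Complex.I]
  push_cast
  field_simp

/-- Tauberian direction: convergence on the positive real axis implies convergence of the means of
the boundary function. -/
theorem tendsto_mean_of_tendsto_real {φ : ℂ → ℂ} (hφ : IsHInfty φ) {α : ℂ}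
    (h : Tendsto (fun x : ℝ => φ x) atTop (𝓝 α)) :
    Tendsto (fun θ : ℝ => (1 / (2 * (θ : ℂ))) * ∫ t in (-θ)..θ, boundaryFunction φ t)
      atTop (𝓝 α) := by
  obtain ⟨K, Φ, hΦ, hd⟩ := hφ.exists_lipschitz_primitive
  obtain ⟨C, hC⟩ := hφ.bounded
  -- The dilations are indexed by the subtype `R > 0` because the Vitali lemma requires holomorphy
  -- and the bound for every index.
  have hscale : ∀ R : Set.Ioi (0 : ℝ), ∀ z ∈ rightHalfPlane,
      (((R : ℝ) : ℂ) * z) ∈ rightHalfPlane := fun R z hz => by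
    change 0 < (((R : ℝ) : ℂ) * z).re
    rw [Complex.re_ofReal_mul]
    exact mul_pos R.2 hz
  have hray : ∀ z : ℂ, 0 < z.re → Tendsto (fun R : ℝ => φ (R * z)) atTop (𝓝 α) := by
    intro z hz
    have h1 := tendsto_of_tendsto_on_pos_real (ι := Set.Ioi (0 : ℝ)) (l := atTop) (C := C)
      (g := fun R z => φ ((R : ℝ) * z)) (α := α)
      (fun R => hφ.differentiableOn.comp (by fun_prop) (hscale R))
      (fun R z hz => hC _ (hscale R z hz))
      (fun x hx => by
        have h2 : Tendsto (fun R : Set.Ioi (0 : ℝ) => (R : ℝ) * x) atTop atTop :=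
          (tendsto_comp_val_Ioi_atTop (f := fun R : ℝ => R * x)).2
            (tendsto_id.atTop_mul_const hx)
        simpa only [Function.comp_def, Complex.ofReal_mul] using h.comp h2) hz
    exact (tendsto_comp_val_Ioi_atTop (f := fun R : ℝ => φ (R * z))).1 h1
  have hIoo : ∀ᵐ s : ℝ, s ∈ Set.uIoc (-(Real.pi / 2)) (Real.pi / 2) →
      s ∈ Set.Ioo (-(Real.pi / 2)) (Real.pi / 2) := by
    filter_upwards [Measure.ae_ne volume (Real.pi / 2)] with s hs hs'
    rw [Set.uIoc_of_le (by linarith [Real.pi_pos])] at hs'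
    exact ⟨hs'.1, lt_of_le_of_ne hs'.2 hs⟩
  have hlim := intervalIntegral.tendsto_integral_filter_of_dominated_convergence
    (μ := volume) (a := -(Real.pi / 2)) (b := Real.pi / 2) (l := (atTop : Filter ℝ))
    (F := fun R s => φ (R * Complex.exp (s * Complex.I)) * Complex.exp (s * Complex.I))
    (f := fun s => α * Complex.exp (s * Complex.I)) (fun _ => C) ?_ ?_ intervalIntegrable_const ?_
  -- The semicircle formula for `φ = 1` shows that the integral of `e^{is}` over `|s| < π/2` is `2`,
  -- which yields the factor one half.
  · have hone : IsHInfty fun _ => 1 := ⟨differentiableOn_const 1, 1, fun _ _ => by simp⟩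
    have hconst := integral_semicircle hone (Φ := id) LipschitzWith.id
      (fun z _ => hasDerivAt_id z) one_pos
    simp only [one_mul, id, Complex.ofReal_one, sub_neg_eq_add, ← two_mul,
      mul_div_cancel_right₀ _ Complex.I_ne_zero] at hconst
    rw [intervalIntegral.integral_const_mul, hconst] at hlim
    have h1 := hlim.div_const 2
    rw [mul_div_cancel_right₀ _ two_ne_zero] at h1
    refine h1.congr' ?_
    filter_upwards [eventually_gt_atTop 0] with R hR
    rw [mean_boundaryFunction hφ hΦ hd, integral_semicircle hφ hΦ hd hR, div_div,
      mul_comm (R * Complex.I : ℂ) 2]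
  · filter_upwards [eventually_gt_atTop 0] with R hR
    exact (intervalIntegrable_semicircle hφ hR).def'.aestronglyMeasurable
  · filter_upwards [eventually_gt_atTop 0] with R hR
    filter_upwards [hIoo] with s hs hs'
    rw [norm_mul, Complex.norm_exp_ofReal_mul_I, mul_one]
    exact hC _ (ofReal_mul_exp_mem_rightHalfPlane hR (hs hs'))
  · filter_upwards [hIoo] with s hs hs'
    refine (hray _ ?_).mul_const _
    simpa [rightHalfPlane] using ofReal_mul_exp_mem_rightHalfPlane one_pos (hs hs')

theorem theorem4p6 (φ : ℂ → ℂ) (hφ : IsHInfty φ) (α : ℂ) :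
    -- the boundary function is well defined almost everywhere
    (∀ᵐ t : ℝ, Tendsto (fun x : ℝ => φ ((x : ℂ) + (t : ℂ) * Complex.I)) (𝓝[>] (0 : ℝ))
      (𝓝 (boundaryFunction φ t))) ∧
    List.TFAE
      [Tendsto (fun θ : ℝ => (1 / (2 * (θ : ℂ))) * ∫ t in (-θ)..θ, boundaryFunction φ t)
          atTop (𝓝 α),
        ∃ y : ℝ, Tendsto (fun x : ℝ => φ ((x : ℂ) + (y : ℂ) * Complex.I)) atTop (𝓝 α),
        ∀ y : ℝ, Tendsto (fun x : ℝ => φ ((x : ℂ) + (y : ℂ) * Complex.I)) atTop (𝓝 α)] := by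
  refine ⟨ae_tendsto_boundaryFunction hφ, ?_⟩
  tfae_have 3 → 1 := fun h => tendsto_mean_of_tendsto_real hφ (by simpa using h 0)
  tfae_have 1 → 2 := fun h => ⟨0, by simpa using tendsto_real_of_tendsto_mean hφ h⟩
  tfae_have 2 → 3 := by
    rintro ⟨y, hy⟩ y'
    simpa using hy.add (hφ.tendsto_sub_horizontal y' y)
  tfae_finish
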